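/- All graphs are finite, simple and undirected. A set $S\subseteq V(H)$ is an odd cycle transversal (OCT) of a graph $H$ if $H-S$ is bipartite; $\mathrm{oct}(H)$ is the minimum size of an OCT of $H$. An odd cycle cut (OCC) of $G$ is a partition $(X_B,X_C,X_R)$ of $V(G)$ into three (possibly empty) parts such that $G[X_B]$ is bipartite, there are no edges between $X_B$ and $X_R$, and $X_C\cup X_B\neq\emptyset$; its width is $|X_C|$. For an integer $z\ge 0$, an OCC $(A_B,A_C,A_R)$ is $z$-tight if $|A_C|=\mathrm{oct}(G[A_C\cup A_B])$ and $G[A_C\cup A_B]$ has a subgraph $H$ such that $A_C$ is a minimum-size OCT of $H$ and $|A_C\cap V(H')|\le z$ for every connected component $H'$ of $H$. Marking. Given an OCC $(X_B,X_C,X_R)$ of $G$, take a proper $2$-coloring $f\colon X_B\to\{0,1\}$ of $G[X_B]$. The auxiliary graph $\tilde G$ is obtained from $G[X_B]$ by adding, for each $v\in X_C$, two vertices $v^{(0)},v^{(1)}$ and, for each neighbor $u\in X_B$ of $v$, the edge $v^{(f(u))}u$. Let $T=\{v^{(i)}: v\in X_C,\ i\in\{0,1\}\}$. Take a set $Z\subseteq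 V(\tilde G)$ such that for every partition $(T_0,T_1,T_2,T_3,T_X)$ of $T$ (parts may be empty), the set $Z$ contains a minimum-size solution of the following problem whenever the problem has a solution of size at most $|T|$: find a set $S\subseteq V(\tilde G)\setminus(T_1\cup T_2\cup T_3)$ that separates $T_i$ from $T_j$ in $\tilde G-T_X$ for all $1\le i<j\le 3$. Put $B^*=Z\cap X_B$. Any set $B^*$ arising in this way, for any choice of $f$ and $Z$, is called a marked set. Reduction. Given a marked set $B^*$, the graph $G'$ is obtained from $G-(X_B\setminus B^*)$ as follows. For every ordered pair $u,v\in X_C\cup B^*$ ($u=v$ allowed) and every parity $p$, suppose there is a path $a,\dots,b$ with at least one vertex ($a=b$ allowed) in $G[X_B\setminus B^*]$ such that $ua,bv\in E(G)$ and the length of $u,a,\dots,b,v$ (that is, the length of the path $a,\dots,b$ plus $2$) has parity $p$. If $p$ is even, add two new vertices $x,x'$, both adjacent to $u$ and $v$; if $p$ is odd, add four new vertices $x,y,x',y'$ and the edges $ux,xy,yv,ux',x'y',y'v$. Lemma. Let $(X_B,X_C,X_R)$ be an OCC of $G$, let $B^*$ be a marked set for it, and let $G'$ be the graph produced by the Reduction.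 Let $z\ge 0$ and let $(A_B,A_C,A_R)$ be a $z$-tight OCC of $G$ such that $A_C\neq\emptyset$ or $A_B\not\subseteq X_B\setminus B^*$. Then $G'$ has a $z$-tight OCC $(A_B',A_C',A_R')$ with $|A_C'|=|A_C|$. -/

import Mathlib

universe u

/-! ### Odd cycle transversals and (tight) odd cycle cuts -/

/-- `S` is an odd cycle transversal of the graph `H` (a subgraph of an ambient graph):
`S ⊆ V(H)` and `H - S` is bipartite. -/
def IsOCT {V : Type u} {G : SimpleGraph V} (H : G.Subgraph) (S : Set V) : Prop :=
  S ⊆ H.verts ∧ (H.deleteVerts S).coe.IsBipartite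

/-- The minimum size of an odd cycle transversal of `H`. -/
noncomputable def octNumber {V : Type u} {G : SimpleGraph V} (H : G.Subgraph) : ℕ :=
  sInf {n : ℕ | ∃ S : Set V, IsOCT H S ∧ S.ncard = n}

/-- An odd cycle cut `(B, C, R)` of `G`: a partition of `V(G)` into three (possibly empty) parts
such that `G[B]` is bipartite, there are no edges between `B` and `R`, and `C ∪ B` is
non-empty. -/
structure OddCycleCut {V : Type u} (G : SimpleGraph V) where
  B : Set V
  C : Set V
  R : Set V
  disjoint_BC : Disjoint B C
  disjoint_BR : Disjoint B R
  disjoint_CR : Disjoint C R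
  union_eq : B ∪ C ∪ R = Set.univ
  bipartite : (G.induce B).IsBipartite
  no_edge : ∀ b ∈ B, ∀ r ∈ R, ¬ G.Adj b r
  nonempty : (C ∪ B).Nonempty

/-- The width `|C|` of an odd cycle cut. -/
noncomputable def OddCycleCut.width {V : Type u} {G : SimpleGraph V} (A : OddCycleCut G) : ℕ :=
  A.C.ncard

/-- The induced subgraph `G[C ∪ B]`. -/
def OddCycleCut.core {V : Type u} {G : SimpleGraph V} (A : OddCycleCut G) : G.Subgraph :=
  (⊤ : G.Subgraph).induce (A.C ∪ A.B)

/-- The subgraph `H` of `G` is a `C`-certificate of order `z`: `C` is an optimal odd cycle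
transversal of `H`, and every connected component of `H` has at most `z` vertices in `C`. -/
def IsCertificate {V : Type u} {G : SimpleGraph V} (C : Set V) (z : ℕ) (H : G.Subgraph) : Prop :=
  IsOCT H C ∧ C.ncard = octNumber H ∧
    ∀ K : H.coe.ConnectedComponent, (C ∩ Subtype.val '' K.supp).ncard ≤ z

/-- A tight odd cycle cut: `|C| = oct(G[C ∪ B])`. -/
def OddCycleCut.IsTight {V : Type u} {G : SimpleGraph V} (A : OddCycleCut G) : Prop :=
  A.C.ncard = octNumber A.core

/-- A `z`-tight odd cycle cut: it is tight and `G[C ∪ B]` contains a `C`-certificate of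
order `z`. -/
def OddCycleCut.IsTightOfOrder {V : Type u} {G : SimpleGraph V} (A : OddCycleCut G) (z : ℕ) :
    Prop :=
  A.IsTight ∧ ∃ H : G.Subgraph, H ≤ A.core ∧ IsCertificate A.C z H

/-! ### Restricted multiway cuts and cut covering sets -/

/-- `X` separates `S` from `T` in `H`: no connected component of `H - X` contains both a vertex
of `S` and a vertex of `T`. -/
def Separates {W : Type u} (H : SimpleGraph W) (X S T : Set W) : Prop :=
  ∀ a b : (Xᶜ : Set W), (a : W) ∈ S → (b : W) ∈ T → ¬ (H.induce Xᶜ).Reachable a b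

/-- The labels of the parts of a generalized `s`-partition `(T₀, T₁, …, Tₛ, T_X)`: the free part,
the `s` active parts, and the deleted part. -/
inductive PartLabel (s : ℕ) : Type
  | free : PartLabel s
  | active (i : Fin s) : PartLabel s
  | deleted : PartLabel s

/-- The part with label `l` of the generalized partition `τ` of the terminal set `T`. A partition
into (possibly empty) labelled parts is given by the map sending each terminal to its label. -/
def partOf {W : Type u} {T : Set W} {s : ℕ} (τ : T → PartLabel s) (l : PartLabel s) : Set W :=
  {w | ∃ h : w ∈ T, τ ⟨w, h⟩ = l}

/-- `S` is a restricted multiway cut of the generalized partition `τ` in `H`: it contains no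
vertex of an active part, and it separates any two different active parts in `H - T_X`
(note that `(H - T_X) - S = H - (T_X ∪ S)`). -/
def IsRestrictedMultiwayCut {W : Type u} (H : SimpleGraph W) {T : Set W} {s : ℕ}
    (τ : T → PartLabel s) (S : Set W) : Prop :=
  (∀ i : Fin s, Disjoint S (partOf τ (.active i))) ∧
    ∀ i j : Fin s, i < j →
      Separates H (partOf τ .deleted ∪ S) (partOf τ (.active i)) (partOf τ (.active j))

/-- `Z` is a cut covering set of `H` for the terminal set `T`: for each generalized `s`-partition
of `T` that has a restricted multiway cut of size at most `|T|`, the set `Z` contains a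
restricted multiway cut of minimum size. -/
def IsCutCovering {W : Type u} (H : SimpleGraph W) (T : Set W) (s : ℕ) (Z : Set W) : Prop :=
  ∀ τ : T → PartLabel s,
    (∃ S : Set W, IsRestrictedMultiwayCut H τ S ∧ S.ncard ≤ T.ncard) →
      ∃ S : Set W, S ⊆ Z ∧ IsRestrictedMultiwayCut H τ S ∧
        ∀ S' : Set W, IsRestrictedMultiwayCut H τ S' → S.ncard ≤ S'.ncard

/-! ### The marking step -/

/-- Vertices of the auxiliary graph of the marking step: the vertices of `X_B`, and two vertices
`v⁽⁰⁾`, `v⁽¹⁾` for each `v ∈ X_C`. -/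
inductive AuxVertex {V : Type u} {G : SimpleGraph V} (X : OddCycleCut G) : Type u
  | vertex (b : X.B) : AuxVertex X
  | terminal (v : X.C) (i : Fin 2) : AuxVertex X

/-- Edges of the auxiliary graph: those of `G[X_B]`, and, for each `v ∈ X_C` and each neighbour
`b ∈ X_B` of `v`, an edge between `v⁽ⁱ⁾` and `b` where `i` is the colour of `b`. -/
inductive AuxEdge {V : Type u} {G : SimpleGraph V} (X : OddCycleCut G)
    (f : (G.induce X.B).Coloring (Fin 2)) : AuxVertex X → AuxVertex X → Prop
  | inside (a b : X.B) : G.Adj a b → AuxEdge X f (.vertex a) (.vertex b)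
  | cross (v : X.C) (b : X.B) : G.Adj v b → AuxEdge X f (.terminal v (f b)) (.vertex b)

/-- The auxiliary graph of the marking step. -/
def auxGraph {V : Type u} {G : SimpleGraph V} (X : OddCycleCut G)
    (f : (G.induce X.B).Coloring (Fin 2)) : SimpleGraph (AuxVertex X) :=
  SimpleGraph.fromRel (AuxEdge X f)

/-- The terminal set `T = {v⁽ⁱ⁾ | v ∈ X_C, i ∈ {0, 1}}`. -/
def auxTerminals {V : Type u} {G : SimpleGraph V} (X : OddCycleCut G) : Set (AuxVertex X) :=
  {w | ∃ (v : X.C) (i : Fin 2), w = .terminal v i}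

/-- `M` is a possible output `B*` of the marking step for the odd cycle cut `X`: for some proper
2-colouring `f` of `G[X_B]` and some cut covering set `Z` (for generalized 3-partitions of the
terminal set) of the auxiliary graph, `M` consists of the vertices of `X_B` that belong to `Z`. -/
def IsMarkedSet {V : Type u} {G : SimpleGraph V} (X : OddCycleCut G) (M : Set V) : Prop :=
  ∃ (f : (G.induce X.B).Coloring (Fin 2)) (Z : Set (AuxVertex X)),
    IsCutCovering (auxGraph X f) (auxTerminals X) 3 Z ∧
      M = {v | ∃ h : v ∈ X.B, AuxVertex.vertex ⟨v, h⟩ ∈ Z}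

/-! ### The reduction -/

/-- `G[D]` connects `u` and `v` by a path whose length satisfies `par` (used with `Even` and
`Odd`): there is a sequence `u, a, …, b, v` whose internal part `a, …, b` is a path `P` of `G[D]`
(with at least one vertex). Its length is `|P| + 2`; the case `u = v` is allowed. -/
def ConnectsThrough {V : Type u} (G : SimpleGraph V) (D : Set V) (par : ℕ → Prop) (u v : V) :
    Prop :=
  ∃ (a b : D) (P : (G.induce D).Walk a b),
    P.IsPath ∧ G.Adj u a ∧ G.Adj b v ∧ par (P.length + 2)

/-- Vertices of the reduced graph for the odd cycle cut `X` and the marked set `M`: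
the vertices of `G - (X_B \ M)`; for all `u, v ∈ X_C ∪ M` connected by an even path through
`G[X_B \ M]` two new vertices `x, x'` (`mid`, indexed by `i`); and for all `u, v ∈ X_C ∪ M`
connected by an odd path through `G[X_B \ M]` four new vertices `x, x'` (`fst`) and
`y, y'` (`snd`). The pairs `(u, v)` are ordered and `u = v` is allowed. -/
inductive ReducedVertex {V : Type u} {G : SimpleGraph V} (X : OddCycleCut G) (M : Set V) : Type u
  | old (v : V) (h : v ∉ X.B \ M) : ReducedVertex X M
  | mid (u v : V) (hu : u ∈ X.C ∪ M) (hv : v ∈ X.C ∪ M)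
      (h : ConnectsThrough G (X.B \ M) Even u v) (i : Bool) : ReducedVertex X M
  | fst (u v : V) (hu : u ∈ X.C ∪ M) (hv : v ∈ X.C ∪ M)
      (h : ConnectsThrough G (X.B \ M) Odd u v) (i : Bool) : ReducedVertex X M
  | snd (u v : V) (hu : u ∈ X.C ∪ M) (hv : v ∈ X.C ∪ M)
      (h : ConnectsThrough G (X.B \ M) Odd u v) (i : Bool) : ReducedVertex X M

/-- Edges of the reduced graph (each listed in one direction): the edges of `G - (X_B \ M)`, and
the edges of the new paths `u, x, v` and `u, x, y, v`. -/
inductive ReducedEdge {V : Type u} {G : SimpleGraph V} (X : OddCycleCut G) (M : Set V) :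
    ReducedVertex X M → ReducedVertex X M → Prop
  | keep (a b : V) (ha hb) : G.Adj a b → ReducedEdge X M (.old a ha) (.old b hb)
  | evenLeft (u v : V) (hu hv h i hu') :
      ReducedEdge X M (.old u hu') (.mid u v hu hv h i)
  | evenRight (u v : V) (hu hv h i hv') :
      ReducedEdge X M (.mid u v hu hv h i) (.old v hv')
  | oddLeft (u v : V) (hu hv h i hu') :
      ReducedEdge X M (.old u hu') (.fst u v hu hv h i)
  | oddMid (u v : V) (hu hv h i) :
      ReducedEdge X M (.fst u v hu hv h i) (.snd u v hu hv h i)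
  | oddRight (u v : V) (hu hv h i hv') :
      ReducedEdge X M (.snd u v hu hv h i) (.old v hv')

/-- The graph `G'` obtained from `G` by the reduction for the odd cycle cut `X` and the marked
set `M`. -/
def reducedGraph {V : Type u} {G : SimpleGraph V} (X : OddCycleCut G) (M : Set V) :
    SimpleGraph (ReducedVertex X M) :=
  SimpleGraph.fromRel (ReducedEdge X M)

/-- The reduced graph of a finite graph is finite. -/
instance {V : Type u} [Finite V] {G : SimpleGraph V} (X : OddCycleCut G) (M : Set V) :
    Finite (ReducedVertex X M) := by
  let g : ReducedVertex X M → V ⊕ (Fin 3 × V × V × Bool)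
    | .old v _ => .inl v
    | .mid u v _ _ _ i => .inr (0, u, v, i)
    | .fst u v _ _ _ i => .inr (1, u, v, i)
    | .snd u v _ _ _ i => .inr (2, u, v, i)
  refine Finite.of_injective g ?_
  intro a b hab
  cases a <;> cases b <;> simp_all [g]

/-- The auxiliary graph of the marking step is finite if `G` is. -/
instance {V : Type u} [Finite V] {G : SimpleGraph V} (X : OddCycleCut G) :
    Finite (AuxVertex X) := by
  let g : AuxVertex X → X.B ⊕ (X.C × Fin 2)
    | .vertex b => .inl b
    | .terminal v i => .inr (v, i)
  refine Finite.of_injective g ?_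
  intro a b hab
  cases a <;> cases b <;> simp_all [g]

/-!
The statement is proved in two independent steps. Write `D = X_B \ M` for the unmarked vertices.
All colourings are encoded as maps `V → Bool` that are proper on the relevant vertices.

**Moving the cut off `D`** (`OddCycleCut.IsTightOfOrder.exists_disjoint_unmarked`). Let `f` be the
colouring of `G[X_B]` used in the marking and `g` a colouring of `G[A_B]`. Comparing the two gives
each vertex of `A_B ∩ X_B` one of two types, constant on components, and the terminals are labelled
accordingly: deleted for `A_C`, third part for `A_R`, and first or second part according to the type
forced by `g` for `A_B`. Then `P = A_C ∩ X_B` is a multiway cut, and the marked set contains a cut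
`S` that is no larger. Replacing `P` by `S` in `A_C` gives the new cut. What has to be checked is
that the core does not lose vertices. That no vertex of `A_C` stays connected to the third part once
`S` is removed is an uncrossing argument
(`forall_mem_or_mem_of_uncrossing`): inside the core, `P` is a minimum separator of the first two
parts, because every such separator yields an odd cycle transversal of the core; the two separators
obtained from `P` and `S` by uncrossing are therefore at least as large as `P`, which leaves no room
for a vertex of `P` that `S` cuts off from both parts. Consequently the vertices of `A_R ∩ X_B` that
stay connected to the third part have only each other as neighbours in `X_B` outside `S`, so they
can serve as the `X_B`-part of the new remainder. The old certificate then lies in the new core,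
and `IsCertificate.exchange` shows that it certifies the new cut.

**Passing to the reduced graph** (`OddCycleCut.IsTightOfOrder.transfer`). If `A_C` avoids `D`, the
paths through `D` stay on one side of the cut, so `A` carries over to the reduced graph
(`transferCut`). The certificate `H` is carried over by keeping its old vertices and adding all new
paths whose ends share a component of `H`. Each odd cycle transversal of the result projects to one
of `H` (`isOCT_base_image`), which gives optimality.
-/

/-! ### Two-colourings and odd cycle transversals -/

theorem isBipartite_iff_exists_bool {W : Type*} (H : SimpleGraph W) :
    H.IsBipartite ↔ ∃ c : W → Bool, ∀ a b, H.Adj a b → c a ≠ c b := by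
  constructor
  · rintro ⟨c⟩
    exact ⟨fun w => finTwoEquiv (c w), fun a b h e => c.valid h (finTwoEquiv.injective e)⟩
  · rintro ⟨c, hc⟩
    exact ⟨SimpleGraph.Coloring.mk (fun w => finTwoEquiv.symm (c w))
      fun {a b} h e => hc a b h (finTwoEquiv.symm.injective e)⟩

theorem induce_isBipartite_iff {V : Type u} {G : SimpleGraph V} (B : Set V) :
    (G.induce B).IsBipartite ↔
      ∃ c : V → Bool, ∀ a ∈ B, ∀ b ∈ B, G.Adj a b → c a ≠ c b := by
  classical
  rw [isBipartite_iff_exists_bool]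
  constructor
  · rintro ⟨c, hc⟩
    refine ⟨fun v => if h : v ∈ B then c ⟨v, h⟩ else false, fun a ha b hb hab => ?_⟩
    simpa [ha, hb] using hc ⟨a, ha⟩ ⟨b, hb⟩ hab
  · rintro ⟨c, hc⟩
    exact ⟨fun v => c v, fun a b hab => hc a a.2 b b.2 hab⟩

theorem isOCT_iff {V : Type u} {G : SimpleGraph V} (H : G.Subgraph) (S : Set V) :
    IsOCT H S ↔ S ⊆ H.verts ∧
      ∃ c : V → Bool, ∀ a b, H.Adj a b → a ∉ S → b ∉ S → c a ≠ c b := by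
  classical
  unfold IsOCT
  rw [isBipartite_iff_exists_bool]
  refine and_congr_right fun _ => ⟨?_, ?_⟩
  · rintro ⟨c, hc⟩
    refine ⟨fun v => if h : v ∈ (H.deleteVerts S).verts then c ⟨v, h⟩ else false,
      fun a b hab ha hb => ?_⟩
    have ha' : a ∈ (H.deleteVerts S).verts := ⟨hab.fst_mem, ha⟩
    have hb' : b ∈ (H.deleteVerts S).verts := ⟨hab.snd_mem, hb⟩
    simp only [dif_pos ha', dif_pos hb']
    refine hc _ _ ?_
    simp only [SimpleGraph.Subgraph.coe_adj, SimpleGraph.Subgraph.deleteVerts_adj]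
    exact ⟨hab.fst_mem, ha, hab.snd_mem, hb, hab⟩
  · rintro ⟨c, hc⟩
    refine ⟨fun v => c v, fun a b hab => ?_⟩
    simp only [SimpleGraph.Subgraph.coe_adj, SimpleGraph.Subgraph.deleteVerts_adj] at hab
    exact hc a b hab.2.2.2.2 hab.2.1 hab.2.2.2.1

theorem octNumber_le_ncard {V : Type u} {G : SimpleGraph V} {H : G.Subgraph} {S : Set V}
    (hS : IsOCT H S) : octNumber H ≤ S.ncard :=
  Nat.sInf_le ⟨S, hS, rfl⟩

/-- A set need not lie inside `H` to bound `octNumber H`: only its part in `H` matters. -/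
theorem octNumber_le_ncard_of_coloring {V : Type u} [Finite V] {G : SimpleGraph V}
    {H : G.Subgraph} {S : Set V} {c : V → Bool}
    (hc : ∀ a b, H.Adj a b → a ∉ S → b ∉ S → c a ≠ c b) :
    octNumber H ≤ (S ∩ H.verts).ncard := by
  refine octNumber_le_ncard ((isOCT_iff H _).2 ⟨Set.inter_subset_right, c, ?_⟩)
  exact fun a b hab ha hb => hc a b hab (fun h => ha ⟨h, hab.fst_mem⟩)
    (fun h => hb ⟨h, hab.snd_mem⟩)

theorem ncard_eq_octNumber {V : Type u} {G : SimpleGraph V} {H : G.Subgraph} {C : Set V}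
    (hC : IsOCT H C) (hmin : ∀ S, IsOCT H S → C.ncard ≤ S.ncard) : C.ncard = octNumber H := by
  refine le_antisymm ?_ (octNumber_le_ncard hC)
  have hne : {n : ℕ | ∃ S : Set V, IsOCT H S ∧ S.ncard = n}.Nonempty := ⟨_, C, hC, rfl⟩
  obtain ⟨S, hS, h⟩ := Nat.sInf_mem hne
  have := hmin S hS
  rw [h] at this
  exact this

/-- A second transversal that is no larger than the certified one inherits the certificate.
On a single component the certified transversal could otherwise be exchanged for it there, and
on the remaining components kept, to give a smaller transversal. -/
theorem IsCertificate.exchange {V : Type u} [Finite V] {G : SimpleGraph V} {H : G.Subgraph}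
    {C C' : Set V} {z : ℕ} (hH : IsCertificate C z H) (hle : C'.ncard ≤ C.ncard)
    {c' : V → Bool} (hc' : ∀ a b, H.Adj a b → a ∉ C' → b ∉ C' → c' a ≠ c' b) :
    IsCertificate C' z H ∧ C'.ncard = C.ncard := by
  classical
  obtain ⟨hO, hmin, hK⟩ := hH
  obtain ⟨hCH, c, hc⟩ := (isOCT_iff H C).1 hO
  have h1 := octNumber_le_ncard_of_coloring hc'
  have h2 : (C' ∩ H.verts).ncard ≤ C'.ncard := Set.ncard_le_ncard Set.inter_subset_left
  have heq : C' ∩ H.verts = C' :=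
    Set.eq_of_subset_of_ncard_le Set.inter_subset_left (by omega)
  have hsub : C' ⊆ H.verts := Set.inter_eq_left.1 heq
  refine ⟨⟨(isOCT_iff H C').2 ⟨hsub, c', hc'⟩, by omega, fun K => ?_⟩, by omega⟩
  set k : Set V := Subtype.val '' K.supp with hk
  have hclosed : ∀ a b, H.Adj a b → (a ∈ k ↔ b ∈ k) := by
    have aux : ∀ a b, H.Adj a b → a ∈ k → b ∈ k := by
      rintro _ b hab ⟨a, ha, rfl⟩
      exact ⟨⟨b, hab.snd_mem⟩, K.mem_supp_of_adj_mem_supp ha hab, rfl⟩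
    exact fun a b hab => ⟨aux a b hab, aux b a hab.symm⟩
  have h3 : octNumber H ≤ ((C ∩ k ∪ C' \ k) ∩ H.verts).ncard := by
    refine octNumber_le_ncard_of_coloring (c := fun v => if v ∈ k then c v else c' v) ?_
    intro a b hab ha hb
    have hiff := hclosed a b hab
    by_cases hak : a ∈ k
    · have hbk := hiff.1 hak
      simp only [if_pos hak, if_pos hbk]
      exact hc a b hab (fun h => ha (.inl ⟨h, hak⟩)) (fun h => hb (.inl ⟨h, hbk⟩))
    · have hbk := fun h => hak (hiff.2 h)
      simp only [if_neg hak, if_neg hbk]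
      exact hc' a b hab (fun h => ha (.inr ⟨h, hak⟩)) (fun h => hb (.inr ⟨h, hbk⟩))
  have h4 : ((C ∩ k ∪ C' \ k) ∩ H.verts).ncard ≤ (C ∩ k ∪ C' \ k).ncard :=
    Set.ncard_le_ncard Set.inter_subset_left
  have h5 := Set.ncard_union_le (C ∩ k) (C' \ k)
  have h6 := Set.ncard_inter_add_ncard_sdiff_eq_ncard C' k
  have h7 : (C ∩ k).ncard ≤ z := hK K
  omega

/-! ### Odd cycle cuts -/

namespace OddCycleCut

variable {V : Type u} {G : SimpleGraph V}

theorem mem_cases (A : OddCycleCut G) (v : V) : v ∈ A.B ∨ v ∈ A.C ∨ v ∈ A.R := by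
  have : v ∈ A.B ∪ A.C ∪ A.R := A.union_eq ▸ Set.mem_univ v
  rcases this with (h | h) | h <;> simp [h]

theorem notMem_C_of_mem_B (A : OddCycleCut G) {v : V} (h : v ∈ A.B) : v ∉ A.C :=
  Set.disjoint_left.1 A.disjoint_BC h

theorem notMem_R_of_mem_B (A : OddCycleCut G) {v : V} (h : v ∈ A.B) : v ∉ A.R :=
  Set.disjoint_left.1 A.disjoint_BR h

theorem notMem_R_of_mem_C (A : OddCycleCut G) {v : V} (h : v ∈ A.C) : v ∉ A.R :=
  Set.disjoint_left.1 A.disjoint_CR h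

theorem mem_B_of_notMem (A : OddCycleCut G) {v : V} (hC : v ∉ A.C) (hR : v ∉ A.R) : v ∈ A.B := by
  have := A.mem_cases v
  tauto

theorem mem_B_of_adj (A : OddCycleCut G) {a b : V} (ha : a ∈ A.B) (hab : G.Adj a b)
    (hb : b ∉ A.C) : b ∈ A.B :=
  A.mem_B_of_notMem hb fun h => A.no_edge a ha b h hab

theorem core_adj (A : OddCycleCut G) {a b : V} :
    A.core.Adj a b ↔ a ∈ A.C ∪ A.B ∧ b ∈ A.C ∪ A.B ∧ G.Adj a b := by
  simp [core]

theorem exists_coloring (A : OddCycleCut G) :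
    ∃ g : V → Bool, ∀ a ∈ A.B, ∀ b ∈ A.B, G.Adj a b → g a ≠ g b :=
  (induce_isBipartite_iff A.B).1 A.bipartite

theorem isOCT_of_le_core (A : OddCycleCut G) {H : G.Subgraph} (hH : H ≤ A.core)
    (hC : A.C ⊆ H.verts) : IsOCT H A.C := by
  obtain ⟨g, hg⟩ := A.exists_coloring
  refine (isOCT_iff H _).2 ⟨hC, g, fun a b hab ha hb => ?_⟩
  obtain ⟨ha', hb', h⟩ := A.core_adj.1 (hH.2 hab)
  exact hg a (ha'.resolve_left ha) b (hb'.resolve_left hb) h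

/-- Tightness is a consequence of the existence of a certificate. -/
theorem isTightOfOrder_of_isCertificate [Finite V] (A : OddCycleCut G) {z : ℕ} {H : G.Subgraph}
    (hH : H ≤ A.core) (hcert : IsCertificate A.C z H) : A.IsTightOfOrder z := by
  refine ⟨ncard_eq_octNumber (A.isOCT_of_le_core le_rfl Set.subset_union_left) ?_, H, hH, hcert⟩
  intro S hS
  obtain ⟨-, c, hc⟩ := (isOCT_iff _ _).1 hS
  have h1 := octNumber_le_ncard_of_coloring (H := H) (S := S) (c := c)
    fun a b hab => hc a b (hH.2 hab)
  have h2 : (S ∩ H.verts).ncard ≤ S.ncard := Set.ncard_le_ncard Set.inter_subset_left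
  have h3 := hcert.2.1
  omega

theorem IsTight.ncard_le [Finite V] {A : OddCycleCut G} (hA : A.IsTight) {S : Set V}
    {c : V → Bool} (hc : ∀ a ∈ A.C ∪ A.B, ∀ b ∈ A.C ∪ A.B, G.Adj a b →
      a ∉ S → b ∉ S → c a ≠ c b) : A.C.ncard ≤ S.ncard := by
  have h1 := octNumber_le_ncard_of_coloring (H := A.core) (S := S) (c := c) fun a b hab => by
    obtain ⟨ha, hb, h⟩ := A.core_adj.1 hab
    exact hc a ha b hb h
  have h2 : (S ∩ A.core.verts).ncard ≤ S.ncard := Set.ncard_le_ncard Set.inter_subset_left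
  have h3 : A.C.ncard = octNumber A.core := hA
  omega

end OddCycleCut

/-! ### Auxiliary facts on reachability and cardinality -/

theorem SimpleGraph.Reachable.eq_of_adj_imp_eq {W α : Type*} {H : SimpleGraph W} {t : W → α}
    (ht : ∀ a b, H.Adj a b → t a = t b) {a b : W} (h : H.Reachable a b) : t a = t b := by
  obtain ⟨p⟩ := h
  induction p with
  | nil => rfl
  | cons hab _ ih => exact (ht _ _ hab).trans ih

theorem Set.ncard_preimage_le_of_injective {α β : Type*} [Finite β] {f : α → β}
    (hf : Function.Injective f) (s : Set β) : (f ⁻¹' s).ncard ≤ s.ncard := by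
  rw [← Set.ncard_image_of_injective _ hf]
  exact Set.ncard_le_ncard (Set.image_preimage_subset f s)

/-! ### Extracting a cut from the marked set -/

theorem IsMarkedSet.subset_B {V : Type u} {G : SimpleGraph V} {X : OddCycleCut G} {M : Set V}
    (hM : IsMarkedSet X M) : M ⊆ X.B := by
  obtain ⟨f, Z, -, rfl⟩ := hM
  rintro v ⟨h, -⟩
  exact h

/-- The covering property of a marked set, restated in the graph `G` itself. A terminal `v⁽ⁱ⁾` is
labelled by `lab v i`, no terminal being free. A multiway cut `P ⊆ X_B` is presented by a map `t`
sending each vertex of `X_B \ P` to the part with which it may be connected. The sets `Q k` are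
the vertices of `X_B` that remain connected to the `k`-th part when `S` is removed. -/
theorem IsMarkedSet.exists_cut {V : Type u} [Finite V] {G : SimpleGraph V} {X : OddCycleCut G}
    {M : Set V} (hM : IsMarkedSet X M) :
    ∃ f : V → Bool, (∀ a ∈ X.B, ∀ b ∈ X.B, G.Adj a b → f a ≠ f b) ∧
      ∀ (lab : V → Bool → PartLabel 3) (P : Set V) (t : V → Fin 3),
        (∀ v i, lab v i ≠ .free) → P ⊆ X.B → P.ncard ≤ X.C.ncard →
        (∀ a ∈ X.B \ P, ∀ b ∈ X.B \ P, G.Adj a b → t a = t b) →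
        (∀ v ∈ X.C, ∀ b ∈ X.B \ P, G.Adj v b → ∀ k, lab v (f b) = .active k → t b = k) →
        ∃ (S : Set V) (Q : Fin 3 → Set V), S ⊆ M ∧ S.ncard ≤ P.ncard ∧
          (∀ k, Q k ⊆ X.B \ S) ∧
          (∀ k, ∀ a ∈ Q k, ∀ b ∈ X.B \ S, G.Adj a b → b ∈ Q k) ∧
          (∀ v ∈ X.C, ∀ b ∈ X.B \ S, G.Adj v b → ∀ k, lab v (f b) = .active k → b ∈ Q k) ∧
          ∀ j k, ∀ a ∈ Q j, a ∈ Q k → j = k := by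
  classical
  obtain ⟨f, Z, hZ, rfl⟩ := hM
  let f' : V → Bool := fun v => if h : v ∈ X.B then finTwoEquiv (f ⟨v, h⟩) else false
  have hf' : ∀ b : X.B, f' b = finTwoEquiv (f b) := fun b => by simp [f']
  refine ⟨f', fun a ha b hb hab e => ?_, ?_⟩
  · rw [hf' ⟨a, ha⟩, hf' ⟨b, hb⟩] at e
    exact f.valid (v := ⟨a, ha⟩) (w := ⟨b, hb⟩) hab (finTwoEquiv.injective e)
  intro lab P t hfree hPB hPC htin htcross
  let lab' : AuxVertex X → PartLabel 3
    | .vertex _ => .free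
    | .terminal v i => lab v (finTwoEquiv i)
  let τ : auxTerminals X → PartLabel 3 := fun w => lab' w
  have hpart : ∀ (v : X.C) i l,
      AuxVertex.terminal v i ∈ partOf τ l ↔ lab v (finTwoEquiv i) = l := fun v i l =>
    ⟨fun ⟨_, h⟩ => h, fun h => ⟨⟨v, i, rfl⟩, h⟩⟩
  have hpartv : ∀ (b : X.B) l, AuxVertex.vertex b ∉ partOf τ l := by
    rintro b l ⟨⟨v, i, h⟩, -⟩
    cases h
  have hinj : Function.Injective (AuxVertex.vertex (X := X)) := fun a b h => by
    cases h
    rfl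
  let P' : Set (AuxVertex X) := AuxVertex.vertex '' (Subtype.val ⁻¹' P)
  have hP' : ∀ b : X.B, AuxVertex.vertex b ∈ P' ↔ (b : V) ∈ P := fun b =>
    hinj.mem_set_image
  have hP'card : P'.ncard ≤ P.ncard := by
    rw [Set.ncard_image_of_injective _ hinj]
    exact Set.ncard_preimage_le_of_injective Subtype.val_injective P
  have hcut : IsRestrictedMultiwayCut (auxGraph X f) τ P' := by
    refine ⟨fun i => Set.disjoint_left.2 ?_, fun i j hij a b ha hb hr => ?_⟩
    · rintro _ ⟨b, -, rfl⟩
      exact hpartv _ _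
    let ty : AuxVertex X → Fin 3
      | .vertex b => t b
      | .terminal v i => match lab v (finTwoEquiv i) with
        | .active k => k
        | _ => 0
    have hty : ∀ w k, w ∈ partOf τ (.active k) → ty w = k := by
      rintro (b | ⟨v, i⟩) k hw
      · exact absurd hw (hpartv _ _)
      · rw [hpart] at hw
        simp [ty, hw]
    have hedge : ∀ a b : AuxVertex X, AuxEdge X f a b → a ∉ partOf τ .deleted ∪ P' →
        b ∉ partOf τ .deleted ∪ P' → ty a = ty b := by
      rintro _ _ (⟨a, b, hab⟩ | ⟨v, b, hvb⟩) ha hb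
      · exact htin a ⟨a.2, fun h => ha (.inr ((hP' a).2 h))⟩ b
          ⟨b.2, fun h => hb (.inr ((hP' b).2 h))⟩ hab
      · have hbP : (b : V) ∈ X.B \ P := ⟨b.2, fun h => hb (.inr ((hP' b).2 h))⟩
        rcases hl : lab v (finTwoEquiv (f b)) with _ | k | _
        · exact absurd hl (hfree _ _)
        · rw [hty _ k ((hpart _ _ _).2 hl)]
          exact (htcross v v.2 b hbP hvb k (by rw [hf', hl])).symm
        · exact absurd (.inl ((hpart _ _ _).2 hl)) ha
    have := SimpleGraph.Reachable.eq_of_adj_imp_eq (t := fun w => ty w.1)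
      (fun a b hab => by
        have h : (auxGraph X f).Adj a b := hab
        rw [auxGraph, SimpleGraph.fromRel_adj] at h
        rcases h.2 with h | h
        · exact hedge _ _ h a.2 b.2
        · exact (hedge _ _ h b.2 a.2).symm) hr
    simp only [hty _ _ ha, hty _ _ hb] at this
    exact hij.ne this
  have hTcard : X.C.ncard ≤ (auxTerminals X).ncard := by
    have hinjT : Function.Injective (fun v : X.C => AuxVertex.terminal v 0) := by
      intro a b h
      cases h
      rfl
    rw [← Nat.card_coe_set_eq, ← Set.ncard_univ, ← Set.ncard_image_of_injective _ hinjT]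
    refine Set.ncard_le_ncard ?_
    rintro _ ⟨v, -, rfl⟩
    exact ⟨v, 0, rfl⟩
  obtain ⟨S, hSZ, ⟨hSact, hSsep⟩, hSmin⟩ := hZ τ ⟨P', hcut, by omega⟩
  have hSP := hSmin P' hcut
  let Del : Set (AuxVertex X) := partOf τ .deleted ∪ S
  let S' : Set V := Subtype.val '' (AuxVertex.vertex ⁻¹' S)
  have hDel : ∀ v (h : v ∈ X.B), v ∉ S' → AuxVertex.vertex ⟨v, h⟩ ∈ Delᶜ := by
    rintro v h hv (hd | hd)
    · exact hpartv _ _ hd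
    · exact hv ⟨⟨v, h⟩, hd, rfl⟩
  have hS'card : S'.ncard ≤ S.ncard :=
    (Set.ncard_image_le).trans (Set.ncard_preimage_le_of_injective hinj S)
  refine ⟨S', fun k => {u | ∃ (h : u ∈ X.B) (a b : ↥Delᶜ), b.1 = .vertex ⟨u, h⟩ ∧
    a.1 ∈ partOf τ (.active k) ∧ ((auxGraph X f).induce Delᶜ).Reachable a b}, ?_, by omega,
    ?_, ?_, ?_, ?_⟩
  · rintro _ ⟨b, hb, rfl⟩
    exact ⟨b.2, hSZ hb⟩
  · rintro k u ⟨h, a, b, hb, -, -⟩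
    refine ⟨h, ?_⟩
    rintro ⟨u, hu, rfl⟩
    exact b.2 (.inr (hb ▸ hu))
  · rintro k u ⟨h, a, b, hb, ha, hr⟩ w ⟨hw, hwS⟩ huw
    refine ⟨hw, a, ⟨_, hDel w hw hwS⟩, rfl, ha, hr.trans (SimpleGraph.Adj.reachable ?_)⟩
    simp only [SimpleGraph.comap_adj, Function.Embedding.subtype_apply, hb, auxGraph,
      SimpleGraph.fromRel_adj]
    refine ⟨fun e => ?_, .inl (.inside _ _ huw)⟩
    cases e
    exact huw.ne rfl
  · rintro v hv b ⟨hb, hbS⟩ hvb k hk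
    have hk' : AuxVertex.terminal ⟨v, hv⟩ (f ⟨b, hb⟩) ∈ partOf τ (.active k) := by
      rw [hpart, ← hf' ⟨b, hb⟩]
      exact hk
    refine ⟨hb, ⟨.terminal ⟨v, hv⟩ (f ⟨b, hb⟩), ?_⟩, ⟨_, hDel b hb hbS⟩, rfl, hk',
      SimpleGraph.Adj.reachable ?_⟩
    · rintro (hd | hd)
      · rw [hpart] at hd hk'
        rw [hd] at hk'
        cases hk'
      · exact Set.disjoint_left.1 (hSact k) hd hk'
    · change (SimpleGraph.fromRel (AuxEdge X f)).Adj _ _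
      rw [SimpleGraph.fromRel_adj]
      exact ⟨fun e => (by cases e), .inl (.cross ⟨v, hv⟩ ⟨b, hb⟩ hvb)⟩
  · rintro j k u ⟨h, a, b, hb, ha, hr⟩ ⟨h', a', b', hb', ha', hr'⟩
    have hbb : b = b' := Subtype.ext (hb.trans hb'.symm)
    subst hbb
    rcases lt_trichotomy j k with hjk | hjk | hjk
    · exact absurd (hr.trans hr'.symm) (hSsep j k hjk a a' ha ha')
    · exact hjk
    · exact absurd (hr'.trans hr.symm) (hSsep k j hjk a' a ha' ha)

/-! ### Moving the cut into the marked set -/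

/-- Gluing two colourings: `f` is used on `N ⊆ X_B`, flipped where `σ` says so, and `g` is used on
`A_B` outside `X_B`. The hypotheses say that the flip is constant along edges of `N` and that it
agrees with `g` across the boundary. -/
theorem OddCycleCut.glue_coloring {V : Type u} {G : SimpleGraph V} {X A : OddCycleCut G}
    {f g σ : V → Bool} {N : Set V}
    (hf : ∀ a ∈ X.B, ∀ b ∈ X.B, G.Adj a b → f a ≠ f b)
    (hg : ∀ a ∈ A.B, ∀ b ∈ A.B, G.Adj a b → g a ≠ g b) (hN : N ⊆ X.B)
    (hin : ∀ a ∈ N, ∀ b ∈ N, G.Adj a b → σ a = σ b)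
    (hcross : ∀ v ∈ X.C, v ∈ A.B → ∀ b ∈ N, G.Adj v b → σ b = (f b == g v)) :
    ∃ c : V → Bool, ∀ a ∈ A.B \ X.B ∪ N, ∀ b ∈ A.B \ X.B ∪ N, G.Adj a b → c a ≠ c b := by
  classical
  refine ⟨fun v => if v ∈ X.B then xor (f v) (σ v) else g v, ?_⟩
  have hmix : ∀ a ∈ A.B \ X.B, ∀ b ∈ N, G.Adj a b → g a ≠ xor (f b) (σ b) := by
    rintro a ⟨haA, haX⟩ b hb hab
    have haC : a ∈ X.C := by
      by_contra h
      exact haX (X.mem_B_of_adj (hN hb) hab.symm h)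
    rw [hcross a haC haA b hb hab]
    cases f b <;> cases g a <;> simp
  rintro a (ha | ha) b (hb | hb) hab
  · simp only [if_neg ha.2, if_neg hb.2]
    exact hg a ha.1 b hb.1 hab
  · simp only [if_neg ha.2, if_pos (hN hb)]
    exact hmix a ha b hb hab
  · simp only [if_neg hb.2, if_pos (hN ha)]
    exact (hmix b hb a ha hab.symm).symm
  · simp only [if_pos (hN ha), if_pos (hN hb), hin a ha b hb hab]
    have := hf a (hN ha) b (hN hb) hab
    simpa using this

/-- Uncrossing. `P` and `S` are to be thought of as separators between two sets of terminals; the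
sides are `α = true` and `α = false` for `P`, and `Q₀` and `Q₁` for `S`. The two sets in the
hypotheses bound the intersection of the first sides and that of the second sides. They are disjoint
outside `P ∩ S`, so if both have at least `|P|` elements and `|S| ≤ |P|`, then together they cover
`P ∪ S`. -/
theorem forall_mem_or_mem_of_uncrossing {V : Type u} [Finite V] {P S Q₀ Q₁ : Set V}
    {α : V → Bool} (hSP : S.ncard ≤ P.ncard)
    (hQ : Disjoint Q₀ Q₁)
    (h₀ : P.ncard ≤ {u | u ∈ P ∪ S ∧ (u ∈ P ∨ α u = true) ∧ (u ∈ S ∨ u ∈ Q₀)}.ncard)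
    (h₁ : P.ncard ≤ {u | u ∈ P ∪ S ∧ (u ∈ P ∨ α u = false) ∧ (u ∈ S ∨ u ∈ Q₁)}.ncard) :
    ∀ u ∈ P, u ∈ S ∨ u ∈ Q₀ ∨ u ∈ Q₁ := by
  set C₀ := {u | u ∈ P ∪ S ∧ (u ∈ P ∨ α u = true) ∧ (u ∈ S ∨ u ∈ Q₀)}
  set C₁ := {u | u ∈ P ∪ S ∧ (u ∈ P ∨ α u = false) ∧ (u ∈ S ∨ u ∈ Q₁)}
  have hinter : C₀ ∩ C₁ ⊆ P ∩ S := by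
    rintro u ⟨⟨-, h1, h2⟩, -, h3, h4⟩
    have hS : u ∈ S := by
      by_contra h
      exact Set.disjoint_left.1 hQ (h2.resolve_left h) (h4.resolve_left h)
    refine ⟨?_, hS⟩
    by_contra h
    have := h1.resolve_left h
    rw [h3.resolve_left h] at this
    cases this
  have hunion : C₀ ∪ C₁ ⊆ P ∪ S := by
    rintro u (h | h) <;> exact h.1
  have e1 := Set.ncard_union_add_ncard_inter C₀ C₁
  have e2 := Set.ncard_union_add_ncard_inter P S
  have e3 := Set.ncard_le_ncard hinter
  have heq : C₀ ∪ C₁ = P ∪ S := Set.eq_of_subset_of_ncard_le hunion (by omega)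
  intro u hu
  have : u ∈ C₀ ∪ C₁ := heq ▸ Or.inl hu
  rcases this with ⟨-, -, h⟩ | ⟨-, -, h⟩ <;> tauto

/-- A tight odd cycle cut meets `X_B` in at most `|X_C|` vertices: these vertices could be exchanged
for `X_C ∩ A_B`. -/
theorem OddCycleCut.IsTight.ncard_inter_le {V : Type u} [Finite V] {G : SimpleGraph V}
    {A : OddCycleCut G} (hA : A.IsTight) (X : OddCycleCut G) :
    (A.C ∩ X.B).ncard ≤ X.C.ncard := by
  classical
  obtain ⟨f, hf⟩ := X.exists_coloring
  obtain ⟨g, hg⟩ := A.exists_coloring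
  have h := hA.ncard_le (S := A.C \ X.B ∪ X.C) (c := fun v => if v ∈ X.B then f v else g v) ?_
  · have h1 := Set.ncard_union_le (A.C \ X.B) X.C
    have h2 := Set.ncard_inter_add_ncard_sdiff_eq_ncard A.C X.B
    omega
  intro a ha b hb hab haS hbS
  have key : ∀ a ∈ X.B, ∀ b, G.Adj a b → b ∉ X.C → b ∈ X.B := fun a ha b hab hb =>
    X.mem_B_of_adj ha hab hb
  have haC : a ∉ X.C := fun h => haS (.inr h)
  have hbC : b ∉ X.C := fun h => hbS (.inr h)
  by_cases haX : a ∈ X.B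
  · have hbX := key a haX b hab hbC
    simp only [if_pos haX, if_pos hbX]
    exact hf a haX b hbX hab
  · have hbX : b ∉ X.B := fun h => haX (key b h a hab.symm haC)
    simp only [if_neg haX, if_neg hbX]
    exact hg a (ha.resolve_left fun h => haS (.inl ⟨h, haX⟩)) b
      (hb.resolve_left fun h => hbS (.inl ⟨h, hbX⟩)) hab

/-- Every tight odd cycle cut of order `z` can be changed into one of the same width whose cut
avoids the unmarked vertices of `X_B`, without losing vertices of the core. -/
theorem OddCycleCut.IsTightOfOrder.exists_disjoint_unmarked {V : Type u} [Finite V]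
    {G : SimpleGraph V} {X : OddCycleCut G} {M : Set V} (hM : IsMarkedSet X M) {z : ℕ}
    {A : OddCycleCut G} (hA : A.IsTightOfOrder z) :
    ∃ A' : OddCycleCut G, A'.IsTightOfOrder z ∧ A'.width = A.width ∧
      Disjoint A'.C (X.B \ M) ∧ A.C ∪ A.B ⊆ A'.C ∪ A'.B := by
  classical
  have hMB := hM.subset_B
  obtain ⟨f, hf, hcov⟩ := hM.exists_cut
  obtain ⟨g, hg⟩ := A.exists_coloring
  obtain ⟨hT, H, hHle, hH⟩ := hA
  let lab : V → Bool → PartLabel 3 := fun v i =>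
    if v ∈ A.C then .deleted else if v ∈ A.R then .active 2 else
      if i = g v then .active 0 else .active 1
  have hlabB : ∀ v ∈ A.B, ∀ i, lab v i = if i = g v then .active 0 else .active 1 :=
    fun v hv i => by simp [lab, A.notMem_C_of_mem_B hv, A.notMem_R_of_mem_B hv]
  set P : Set V := A.C ∩ X.B 
  have hPcard : P.ncard + (A.C \ X.B).ncard = A.C.ncard :=
    Set.ncard_inter_add_ncard_sdiff_eq_ncard A.C X.B
  have hPA : ∀ b ∈ X.B \ P, b ∉ A.C := fun b hb h => hb.2 ⟨h, hb.1⟩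
  obtain ⟨S, Q, hSM, hSP, hQS, hQin, hQcross, hQdisj⟩ := hcov lab P
    (fun u => if u ∈ A.R then 2 else if f u = g u then 1 else 0)
    (fun v i => by simp only [lab]; split_ifs <;> simp)
    Set.inter_subset_right (hT.ncard_inter_le X) (by
      intro a ha b hb hab
      by_cases haR : a ∈ A.R
      · have hbR : b ∈ A.R := by
          by_contra h
          exact A.no_edge b (A.mem_B_of_notMem (hPA b hb) h) a haR hab.symm
        simp [haR, hbR]
      · have haB := A.mem_B_of_notMem (hPA a ha) haR
        have hbB := A.mem_B_of_adj haB hab (hPA b hb)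
        have h1 := hf a ha.1 b hb.1 hab
        have h2 := hg a haB b hbB hab
        simp only [haR, A.notMem_R_of_mem_B hbB, if_false]
        revert h1 h2
        cases f a <;> cases f b <;> cases g a <;> cases g b <;> simp) (by
      intro v hv b hb hvb k hk
      rcases A.mem_cases v with hvA | hvA | hvA
      · have hbB := A.mem_B_of_adj hvA hvb (hPA b hb)
        have h2 := hg v hvA b hbB hvb
        rw [hlabB v hvA] at hk
        simp only [A.notMem_R_of_mem_B hbB, if_false]
        revert hk h2
        cases f b <;> cases g v <;> cases g b <;> simp
      · simp [lab, hvA] at hk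
      · have hbR : b ∈ A.R := by
          by_contra h
          exact A.no_edge b (A.mem_B_of_notMem (hPA b hb) h) v hvA hvb.symm
        have hvC : v ∉ A.C := fun h => A.notMem_R_of_mem_C h hvA
        simpa [lab, hvC, hvA, hbR] using hk)
  have hSX : S ⊆ X.B := hSM.trans hMB
  set F : Set V := A.C ∪ A.B
  -- The part of `A_C` outside `X_B`, together with any `C₀ ⊆ X_B` that separates the types `0`
  -- and `1` inside the core, is an odd cycle transversal of the core.
  have hlower : ∀ (C₀ : Set V) (σ : V → Bool),
      (∀ a ∈ (X.B ∩ F) \ C₀, ∀ b ∈ (X.B ∩ F) \ C₀, G.Adj a b → σ a = σ b) →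
      (∀ v ∈ X.C, v ∈ A.B → ∀ b ∈ (X.B ∩ F) \ C₀, G.Adj v b → σ b = (f b == g v)) →
      P.ncard ≤ C₀.ncard := by
    intro C₀ σ hin hcross
    obtain ⟨c, hc⟩ := OddCycleCut.glue_coloring (N := (X.B ∩ F) \ C₀) hf hg
      (fun u hu => hu.1.1) hin hcross
    have hmem : ∀ a ∈ F, a ∉ A.C \ X.B ∪ C₀ → a ∈ A.B \ X.B ∪ (X.B ∩ F) \ C₀ := by
      intro a ha haS
      by_cases haX : a ∈ X.B
      · exact .inr ⟨⟨haX, ha⟩, fun h => haS (.inr h)⟩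
      · exact .inl ⟨ha.resolve_left fun h => haS (.inl ⟨h, haX⟩), haX⟩
    have h := hT.ncard_le (S := A.C \ X.B ∪ C₀) (c := c) fun a ha b hb hab haS hbS =>
      hc a (hmem a ha haS) b (hmem b hb hbS) hab
    have h1 := Set.ncard_union_le (A.C \ X.B) C₀
    omega
  -- Inside the core the type of a vertex off `P` is `xor (f u) (g u)`: `true` belongs to part `0`
  -- and `false` to part `1`.
  have hQ01 : Disjoint (Q 0) (Q 1) := Set.disjoint_left.2 fun u h h' =>
    absurd (hQdisj 0 1 u h h') (by decide)
  have hFB : ∀ u ∈ X.B ∩ F, u ∉ P → u ∈ A.B := fun u hu h =>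
    hu.2.resolve_left fun h' => h ⟨h', hu.1⟩
  have hcross0 : ∀ v ∈ X.C, v ∈ A.B → ∀ b ∈ X.B \ S, G.Adj v b → f b = g v → b ∈ Q 0 :=
    fun v hv hvA b hb hvb e => hQcross v hv b hb hvb 0 (by rw [hlabB v hvA, if_pos e])
  have hcross1 : ∀ v ∈ X.C, v ∈ A.B → ∀ b ∈ X.B \ S, G.Adj v b → f b ≠ g v → b ∈ Q 1 :=
    fun v hv hvA b hb hvb e => hQcross v hv b hb hvb 1 (by rw [hlabB v hvA, if_neg e])
  have hα : ∀ a ∈ X.B ∩ F, a ∉ P → ∀ b ∈ X.B ∩ F, b ∉ P → G.Adj a b →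
      xor (f a) (g a) = xor (f b) (g b) := by
    intro a ha haP b hb hbP hab
    have h1 := hf a ha.1 b hb.1 hab
    have h2 := hg a (hFB a ha haP) b (hFB b hb hbP) hab
    revert h1 h2
    cases f a <;> cases f b <;> cases g a <;> cases g b <;> simp
  have hαcross : ∀ v ∈ A.B, ∀ b ∈ X.B ∩ F, b ∉ P → G.Adj v b →
      xor (f b) (g b) = (f b == g v) := by
    intro v hv b hb hbP hvb
    have h2 := hg v hv b (hFB b hb hbP) hvb
    revert h2
    cases f b <;> cases g b <;> cases g v <;> simp
  -- The two uncrossed separators, each with the region it bounds as one side and everything else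
  -- as the other.
  have huncross := forall_mem_or_mem_of_uncrossing (P := P) (S := S) (Q₀ := Q 0) (Q₁ := Q 1)
    (α := fun u => xor (f u) (g u)) hSP hQ01
    (hlower _ (fun u => decide (u ∉ P ∧ xor (f u) (g u) = true ∧ u ∈ Q 0)) (by
      have aux : ∀ a ∈ X.B ∩ F, ∀ b ∈ X.B ∩ F,
          b ∉ {u | u ∈ P ∪ S ∧ (u ∈ P ∨ xor (f u) (g u) = true) ∧ (u ∈ S ∨ u ∈ Q 0)} →
          G.Adj a b → (a ∉ P ∧ xor (f a) (g a) = true ∧ a ∈ Q 0) →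
          (b ∉ P ∧ xor (f b) (g b) = true ∧ b ∈ Q 0) := by
        rintro a ha b hb hbC hab ⟨h1, h2, h3⟩
        have hbα : b ∉ P → xor (f b) (g b) = true := fun h => hα a ha h1 b hb h hab ▸ h2
        have hbQ : b ∉ S → b ∈ Q 0 := fun h => hQin 0 a h3 b ⟨hb.1, h⟩ hab
        simp only [Set.mem_ofPred_eq, Set.mem_union] at hbC
        tauto
      intro a ha b hb hab
      exact decide_eq_decide.2 ⟨aux a ha.1 b hb.1 hb.2 hab, aux b hb.1 a ha.1 ha.2 hab.symm⟩) (by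
      rintro v hv hvA b ⟨hb, hbC⟩ hvb
      have hbα : b ∉ P → xor (f b) (g b) = (f b == g v) := fun h => hαcross v hvA b hb h hvb
      have hbQ : b ∉ S → f b = g v → b ∈ Q 0 := fun h => hcross0 v hv hvA b ⟨hb.1, h⟩ hvb
      simp only [Set.mem_ofPred_eq, Set.mem_union] at hbC
      by_cases e : f b = g v
      · simp only [e, beq_self_eq_true] at hbα ⊢
        rw [decide_eq_true_iff]
        rw [e] at hbC
        tauto
      · have e' : (f b == g v) = false := by simpa using e
        rw [e'] at hbα ⊢
        rw [decide_eq_false_iff_not]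
        rintro ⟨h1, h2, -⟩
        rw [hbα h1] at h2
        cases h2))
    (hlower _ (fun u => !decide (u ∉ P ∧ xor (f u) (g u) = false ∧ u ∈ Q 1)) (by
      have aux : ∀ a ∈ X.B ∩ F, ∀ b ∈ X.B ∩ F,
          b ∉ {u | u ∈ P ∪ S ∧ (u ∈ P ∨ xor (f u) (g u) = false) ∧ (u ∈ S ∨ u ∈ Q 1)} →
          G.Adj a b → (a ∉ P ∧ xor (f a) (g a) = false ∧ a ∈ Q 1) →
          (b ∉ P ∧ xor (f b) (g b) = false ∧ b ∈ Q 1) := by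
        rintro a ha b hb hbC hab ⟨h1, h2, h3⟩
        have hbα : b ∉ P → xor (f b) (g b) = false := fun h => hα a ha h1 b hb h hab ▸ h2
        have hbQ : b ∉ S → b ∈ Q 1 := fun h => hQin 1 a h3 b ⟨hb.1, h⟩ hab
        simp only [Set.mem_ofPred_eq, Set.mem_union] at hbC
        tauto
      intro a ha b hb hab
      exact congrArg _ (decide_eq_decide.2
        ⟨aux a ha.1 b hb.1 hb.2 hab, aux b hb.1 a ha.1 ha.2 hab.symm⟩)) (by
      rintro v hv hvA b ⟨hb, hbC⟩ hvb
      have hbα : b ∉ P → xor (f b) (g b) = (f b == g v) := fun h => hαcross v hvA b hb h hvb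
      have hbQ : b ∉ S → f b ≠ g v → b ∈ Q 1 := fun h => hcross1 v hv hvA b ⟨hb.1, h⟩ hvb
      simp only [Set.mem_ofPred_eq, Set.mem_union] at hbC
      by_cases e : f b = g v
      · have e' : (f b == g v) = true := by simpa using e
        rw [e'] at hbα ⊢
        rw [Bool.not_eq_true', decide_eq_false_iff_not]
        rintro ⟨h1, h2, -⟩
        rw [hbα h1] at h2
        cases h2
      · have e' : (f b == g v) = false := by simpa using e
        rw [e'] at hbα ⊢
        rw [Bool.not_eq_false', decide_eq_true_iff]
        tauto))
  -- Hence no vertex of `A_C` remains connected to `A_R`.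
  have hQC : ∀ u ∈ Q 2, u ∉ A.C := by
    intro u hu huC
    rcases huncross u ⟨huC, (hQS 2 hu).1⟩ with h | h | h
    · exact (hQS 2 hu).2 h
    · exact absurd (hQdisj 0 2 u h hu) (by decide)
    · exact absurd (hQdisj 1 2 u h hu) (by decide)
  -- Only the part of `Q 2` in `A_R` goes into the new remainder. It is still closed under adjacency
  -- off `S`, because a neighbour in `Q 2` is not in `A_C` and hence not in `A_B`.
  set N : Set V := (X.B \ S) \ (Q 2 ∩ A.R)
  obtain ⟨c, hc⟩ := OddCycleCut.glue_coloring (N := N) (σ := fun u => decide (u ∈ Q 0)) hf hg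
    (fun u hu => hu.1.1)
    (fun a ha b hb hab => decide_eq_decide.2
      ⟨fun h => hQin 0 a h b hb.1 hab, fun h => hQin 0 b h a ha.1 hab.symm⟩) (by
    intro v hv hvA b hb hvb
    by_cases e : f b = g v
    · simpa [e] using hcross0 v hv hvA b hb.1 hvb e
    · have e' : (f b == g v) = false := by simpa using e
      rw [e', decide_eq_false_iff_not]
      exact fun h => Set.disjoint_left.1 hQ01 h (hcross1 v hv hvA b hb.1 hvb e))
  have hFsub : ∀ a ∈ F, a ∈ (A.C \ X.B ∪ S) ∪ (A.B \ X.B ∪ N) := by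
    intro a ha
    have haR : a ∉ A.R := fun h => ha.elim (fun h' => A.notMem_R_of_mem_C h' h)
      (fun h' => A.notMem_R_of_mem_B h' h)
    by_cases haX : a ∈ X.B
    · by_cases haS : a ∈ S
      · exact .inl (.inr haS)
      · exact .inr (.inr ⟨⟨haX, haS⟩, fun h => haR h.2⟩)
    · exact ha.imp (fun h => .inl ⟨h, haX⟩) (fun h => .inl ⟨h, haX⟩)
  let A' : OddCycleCut G :=
    { B := A.B \ X.B ∪ N
      C := A.C \ X.B ∪ S
      R := A.R \ X.B ∪ Q 2 ∩ A.R
      disjoint_BC := Set.disjoint_left.2 (by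
        rintro v (h | h) (h' | h')
        · exact A.notMem_C_of_mem_B h.1 h'.1
        · exact h.2 (hSX h')
        · exact h'.2 h.1.1
        · exact h.1.2 h')
      disjoint_BR := Set.disjoint_left.2 (by
        rintro v (h | h) (h' | h')
        · exact A.notMem_R_of_mem_B h.1 h'.1
        · exact A.notMem_R_of_mem_B h.1 h'.2
        · exact h'.2 h.1.1
        · exact h.2 h')
      disjoint_CR := Set.disjoint_left.2 (by
        rintro v (h | h) (h' | h')
        · exact A.notMem_R_of_mem_C h.1 h'.1
        · exact A.notMem_R_of_mem_C h.1 h'.2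
        · exact h'.2 (hSX h)
        · exact (hQS 2 h'.1).2 h)
      union_eq := Set.eq_univ_of_forall fun v => by
        by_cases hvX : v ∈ X.B
        · by_cases hvS : v ∈ S
          · exact .inl (.inr (.inr hvS))
          · by_cases hvQ : v ∈ Q 2 ∩ A.R
            · exact .inr (.inr hvQ)
            · exact .inl (.inl (.inr ⟨⟨hvX, hvS⟩, hvQ⟩))
        · rcases A.mem_cases v with h | h | h
          · exact .inl (.inl (.inl ⟨h, hvX⟩))
          · exact .inl (.inr (.inl ⟨h, hvX⟩))
          · exact .inr (.inl ⟨h, hvX⟩)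
      bipartite := (induce_isBipartite_iff _).2 ⟨c, hc⟩
      no_edge := by
        rintro b (hb | hb) r (hr | hr) hbr
        · exact A.no_edge b hb.1 r hr.1 hbr
        · exact A.no_edge b hb.1 r hr.2 hbr
        · have hrC : r ∈ X.C := by
            by_contra h
            exact hr.2 (X.mem_B_of_adj hb.1.1 hbr h)
          have hrA : r ∉ A.C := fun h => A.notMem_R_of_mem_C h hr.1
          have hbQ : b ∈ Q 2 := hQcross r hrC b hb.1 hbr.symm 2 (by simp [lab, hrA, hr.1])
          refine hb.2 ⟨hbQ, ?_⟩
          by_contra h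
          exact A.no_edge b (A.mem_B_of_notMem (hQC b hbQ) h) r hr.1 hbr
        · have hbQ : b ∈ Q 2 := hQin 2 r hr.1 b hb.1 hbr.symm
          refine hb.2 ⟨hbQ, ?_⟩
          by_contra h
          exact A.no_edge b (A.mem_B_of_notMem (hQC b hbQ) h) r hr.2 hbr
      nonempty := A.nonempty.imp hFsub }
  have hcard : A'.C.ncard ≤ A.C.ncard := by
    have h1 : A'.C.ncard ≤ _ := Set.ncard_union_le (A.C \ X.B) S
    omega
  have hHle' : H ≤ A'.core := hHle.trans (SimpleGraph.Subgraph.induce_mono_right hFsub)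
  obtain ⟨hcert, heq⟩ := hH.exchange (C' := A'.C) hcard (c' := c) fun a b hab ha hb => by
    obtain ⟨ha', hb', h⟩ := A'.core_adj.1 (hHle'.2 hab)
    exact hc a (ha'.resolve_left ha) b (hb'.resolve_left hb) h
  refine ⟨A', A'.isTightOfOrder_of_isCertificate hHle' hcert, heq, ?_, hFsub⟩
  refine Set.disjoint_left.2 ?_
  rintro v (h | h) hv
  · exact h.2 hv.1
  · exact hv.2 (hSM h)

/-! ### Transfer to the reduced graph -/

section Transfer

variable {V : Type u} {G : SimpleGraph V}

/-- A walk that avoids `A_C` stays in `A_B`, where its ends have the same colour exactly if its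
length is even. -/
theorem OddCycleCut.walk_mem_B (A : OddCycleCut G) {D : Set V} (hD : Disjoint A.C D)
    {g : V → Bool} (hg : ∀ a ∈ A.B, ∀ b ∈ A.B, G.Adj a b → g a ≠ g b) {a b : D}
    (p : (G.induce D).Walk a b) (ha : (a : V) ∈ A.B) :
    (b : V) ∈ A.B ∧ (g a = g b ↔ Even p.length) := by
  induction p with
  | nil => exact ⟨ha, by simp⟩
  | @cons a c b hac p ih =>
    have hac' : G.Adj (a : V) c := hac
    have hc : (c : V) ∈ A.B := A.mem_B_of_adj ha hac' fun h => Set.disjoint_left.1 hD h c.2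
    obtain ⟨hb, hiff⟩ := ih hc
    refine ⟨hb, ?_⟩
    rw [SimpleGraph.Walk.length_cons, Nat.even_add_one, ← hiff]
    have := hg a ha c hc hac'
    revert this
    cases g a <;> cases g b <;> cases g c <;> simp

theorem ConnectsThrough.symm {D : Set V} {par : ℕ → Prop} {u v : V}
    (h : ConnectsThrough G D par u v) : ConnectsThrough G D par v u := by
  obtain ⟨a, b, p, hp, hua, hbv, hpar⟩ := h
  exact ⟨b, a, p.reverse, hp.reverse, hbv.symm, hua.symm, by simpa using hpar⟩

theorem ConnectsThrough.notMem_R {A : OddCycleCut G} {D : Set V} (hD : Disjoint A.C D)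
    {par : ℕ → Prop} {u v : V} (h : ConnectsThrough G D par u v) (hu : u ∈ A.B) : v ∉ A.R := by
  obtain ⟨g, hg⟩ := A.exists_coloring
  obtain ⟨a, b, p, -, hua, hbv, -⟩ := h
  have ha : (a : V) ∈ A.B := A.mem_B_of_adj hu hua fun h => Set.disjoint_left.1 hD h a.2
  exact fun hv => A.no_edge _ (A.walk_mem_B hD hg p ha).1 v hv hbv

theorem ConnectsThrough.exists_even {A : OddCycleCut G} {D : Set V} (hD : Disjoint A.C D)
    {g : V → Bool} (hg : ∀ a ∈ A.B, ∀ b ∈ A.B, G.Adj a b → g a ≠ g b)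
    {par : ℕ → Prop} {u v : V} (h : ConnectsThrough G D par u v)
    (hu : u ∈ A.B) (hv : v ∈ A.B) : ∃ n, par n ∧ (g u = g v ↔ Even n) := by
  obtain ⟨a, b, p, -, hua, hbv, hpar⟩ := h
  have ha : (a : V) ∈ A.B := A.mem_B_of_adj hu hua fun h => Set.disjoint_left.1 hD h a.2
  obtain ⟨hb, hiff⟩ := A.walk_mem_B hD hg p ha
  refine ⟨_, hpar, ?_⟩
  rw [Nat.even_add, ← hiff]
  have h1 := hg u hu a ha hua
  have h2 := hg b hb v hv hbv
  revert h1 h2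
  cases g a <;> cases g b <;> cases g u <;> cases g v <;> simp

theorem ConnectsThrough.color_eq {A : OddCycleCut G} {D : Set V} (hD : Disjoint A.C D)
    {g : V → Bool} (hg : ∀ a ∈ A.B, ∀ b ∈ A.B, G.Adj a b → g a ≠ g b) {u v : V}
    (h : ConnectsThrough G D Even u v) (hu : u ∈ A.B) (hv : v ∈ A.B) : g u = g v := by
  obtain ⟨n, hn, hiff⟩ := h.exists_even hD hg hu hv
  exact hiff.2 hn

theorem ConnectsThrough.color_ne {A : OddCycleCut G} {D : Set V} (hD : Disjoint A.C D)
    {g : V → Bool} (hg : ∀ a ∈ A.B, ∀ b ∈ A.B, G.Adj a b → g a ≠ g b) {u v : V}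
    (h : ConnectsThrough G D Odd u v) (hu : u ∈ A.B) (hv : v ∈ A.B) : g u ≠ g v := by
  obtain ⟨n, hn, hiff⟩ := h.exists_even hD hg hu hv
  exact fun e => Nat.not_even_iff_odd.2 hn (hiff.1 e)

variable {X : OddCycleCut G} {M : Set V}

theorem reducedGraph_adj_iff {x y : ReducedVertex X M} :
    (reducedGraph X M).Adj x y ↔ x ≠ y ∧ (ReducedEdge X M x y ∨ ReducedEdge X M y x) :=
  SimpleGraph.fromRel_adj _ _ _

theorem ReducedEdge.adj {x y : ReducedVertex X M} (h : ReducedEdge X M x y) :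
    (reducedGraph X M).Adj x y := by
  refine reducedGraph_adj_iff.2 ⟨?_, .inl h⟩
  rintro rfl
  cases h with
  | keep a b ha hb hab => exact hab.ne rfl

namespace ReducedVertex

/-- The vertex of `G` standing for a vertex of the reduced graph: an old vertex stands for itself,
and a vertex of a new path is represented by the first end `u` of that path. -/
def base : ReducedVertex X M → V
  | .old v _ => v
  | .mid u _ _ _ _ _ => u
  | .fst u _ _ _ _ _ => u
  | .snd u _ _ _ _ _ => u

/-- The other vertex of `G` attached to a vertex of the reduced graph: the second end `v` of the
path for a new vertex, and the vertex itself for an old one. -/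
def target : ReducedVertex X M → V
  | .old v _ => v
  | .mid _ v _ _ _ _ => v
  | .fst _ v _ _ _ _ => v
  | .snd _ v _ _ _ _ => v

end ReducedVertex

open ReducedVertex

/-- The odd cycle cut of the reduced graph that agrees with `A` on the old vertices. A new vertex
is put into the remainder if an end of its path lies there, and into the bipartite part
otherwise. -/
def transferCut (A : OddCycleCut G) (hD : Disjoint A.C (X.B \ M))
    (hne : A.C.Nonempty ∨ ∃ v ∈ A.B, v ∉ X.B \ M) : OddCycleCut (reducedGraph X M) where
  B := {x | base x ∉ A.R ∧ target x ∉ A.R ∧ ∀ v h, x = .old v h → v ∉ A.C}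
  C := {x | ∃ v h, x = .old v h ∧ v ∈ A.C}
  R := {x | base x ∈ A.R ∨ target x ∈ A.R}
  disjoint_BC := Set.disjoint_left.2 fun x hB ⟨v, h, e, hv⟩ => hB.2.2 v h e hv
  disjoint_BR := Set.disjoint_left.2 fun x hB hR => hR.elim hB.1 hB.2.1
  disjoint_CR := Set.disjoint_left.2 (by
    rintro _ ⟨v, h, rfl, hv⟩ hR
    exact hR.elim (A.notMem_R_of_mem_C hv) (A.notMem_R_of_mem_C hv))
  union_eq := Set.eq_univ_of_forall fun x => by
    by_cases h1 : base x ∈ A.R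
    · exact .inr (.inl h1)
    by_cases h2 : target x ∈ A.R
    · exact .inr (.inr h2)
    by_cases h3 : ∃ v h, x = .old v h ∧ v ∈ A.C
    · exact .inl (.inr h3)
    · exact .inl (.inl ⟨h1, h2, fun v h e hv => h3 ⟨v, h, e, hv⟩⟩)
  bipartite := by
    classical
    obtain ⟨g, hg⟩ := A.exists_coloring
    let fstCol : V → V → Bool := fun u v =>
      if u ∈ A.B then !g u else if v ∈ A.B then g v else false
    let c : ReducedVertex X M → Bool
      | .old v _ => g v
      | .mid u v _ _ _ _ => if u ∈ A.B then !g u else !g v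
      | .fst u v _ _ _ _ => fstCol u v
      | .snd u v _ _ _ _ => !fstCol u v
    refine (induce_isBipartite_iff _).2 ⟨c, ?_⟩
    have key : ∀ x y, ReducedEdge X M x y →
        (base x ∉ A.R ∧ target x ∉ A.R ∧ ∀ v h, x = .old v h → v ∉ A.C) →
        (base y ∉ A.R ∧ target y ∉ A.R ∧ ∀ v h, y = .old v h → v ∉ A.C) → c x ≠ c y := by
      intro x y hxy hx hy
      have hold : ∀ v h, (.old v h : ReducedVertex X M) = x ∨ .old v h = y → v ∈ A.B := by
        rintro v h (rfl | rfl)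
        · exact A.mem_B_of_notMem (hx.2.2 v h rfl) hx.1
        · exact A.mem_B_of_notMem (hy.2.2 v h rfl) hy.1
      cases hxy with
      | keep a b ha hb hab => exact hg a (hold a ha (.inl rfl)) b (hold b hb (.inr rfl)) hab
      | evenLeft u v hu hv h i hu' =>
        have huB := hold u hu' (.inl rfl)
        simp [c, huB]
      | evenRight u v hu hv h i hv' =>
        have hvB := hold v hv' (.inr rfl)
        by_cases huB : u ∈ A.B
        · simp [c, huB, h.color_eq hD hg huB hvB]
        · simp [c, huB]
      | oddLeft u v hu hv h i hu' =>
        have huB := hold u hu' (.inl rfl)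
        simp [c, fstCol, huB]
      | oddMid u v hu hv h i => simp [c]
      | oddRight u v hu hv h i hv' =>
        have hvB := hold v hv' (.inr rfl)
        by_cases huB : u ∈ A.B
        · simpa [c, fstCol, huB] using h.color_ne hD hg huB hvB
        · simp [c, fstCol, huB, hvB]
    intro x hx y hy hxy
    rcases (reducedGraph_adj_iff.1 hxy).2 with h | h
    · exact key x y h hx hy
    · exact (key y x h hy hx).symm
  no_edge := by
    -- A new path never joins `A_B` to `A_R`, as it stands for a path that avoids `A_C`.
    have hBR : ∀ {par : ℕ → Prop} {u v : V}, ConnectsThrough G (X.B \ M) par u v →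
        u ∈ A.B → v ∉ A.R := fun h hu => h.notMem_R hD hu
    rintro x ⟨hx1, hx2, hx3⟩ y hy hxy
    have hxold : ∀ v h, x = .old v h → v ∈ A.B := by
      rintro v h rfl
      exact A.mem_B_of_notMem (hx3 v h rfl) hx1
    rcases (reducedGraph_adj_iff.1 hxy).2 with h | h
    · cases h with
      | keep a b ha hb hab =>
        exact A.no_edge a (hxold a ha rfl) b (hy.elim id id) hab
      | evenLeft u v hu hv h i hu' => exact hy.elim hx1 (hBR h (hxold u hu' rfl))
      | evenRight u v hu hv h i hv' => exact hx2 (hy.elim id id)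
      | oddLeft u v hu hv h i hu' => exact hy.elim hx1 (hBR h (hxold u hu' rfl))
      | oddMid u v hu hv h i => exact hy.elim hx1 hx2
      | oddRight u v hu hv h i hv' => exact hx2 (hy.elim id id)
    · cases h with
      | keep a b ha hb hab =>
        exact A.no_edge b (hxold b hb rfl) a (hy.elim id id) hab.symm
      | evenLeft u v hu hv h i hu' => exact hx1 (hy.elim id id)
      | evenRight u v hu hv h i hv' => exact hy.elim (hBR h.symm (hxold v hv' rfl)) hx1
      | oddLeft u v hu hv h i hu' => exact hx1 (hy.elim id id)
      | oddMid u v hu hv h i => exact hy.elim hx1 hx2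
      | oddRight u v hu hv h i hv' => exact hy.elim (hBR h.symm (hxold v hv' rfl)) hx1
  nonempty := by
    rcases hne with ⟨v, hv⟩ | ⟨v, hv, hvD⟩
    · exact ⟨.old v fun h => Set.disjoint_left.1 hD hv h, .inl ⟨v, _, rfl, hv⟩⟩
    · refine ⟨.old v hvD, .inr ⟨A.notMem_R_of_mem_B hv, A.notMem_R_of_mem_B hv, ?_⟩⟩
      rintro _ _ ⟨⟩
      exact A.notMem_C_of_mem_B hv

/-- Two vertices lie in the same connected component of the subgraph `H`. -/
def SameComponent (H : G.Subgraph) (u v : V) : Prop :=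
  ∃ (hu : u ∈ H.verts) (hv : v ∈ H.verts), H.coe.Reachable ⟨u, hu⟩ ⟨v, hv⟩

theorem SameComponent.symm {H : G.Subgraph} {u v : V} (h : SameComponent H u v) :
    SameComponent H v u := by
  obtain ⟨hu, hv, h⟩ := h
  exact ⟨hv, hu, h.symm⟩

theorem SameComponent.trans {H : G.Subgraph} {u v w : V} (h : SameComponent H u v)
    (h' : SameComponent H v w) : SameComponent H u w := by
  obtain ⟨hu, hv, h⟩ := h
  obtain ⟨_, hw, h'⟩ := h'
  exact ⟨hu, hw, h.trans h'⟩

theorem SameComponent.of_adj {H : G.Subgraph} {u v : V} (h : H.Adj u v) : SameComponent H u v :=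
  ⟨h.fst_mem, h.snd_mem, SimpleGraph.Adj.reachable h⟩

theorem SameComponent.refl {H : G.Subgraph} {u : V} (h : u ∈ H.verts) : SameComponent H u u :=
  ⟨h, h, .rfl⟩

/-- The certificate in the reduced graph that corresponds to `H`: the old vertices and edges of
`H`, and all new paths whose two ends lie in the same component of `H`. -/
def transferSubgraph (X : OddCycleCut G) (M : Set V) (H : G.Subgraph) :
    (reducedGraph X M).Subgraph where
  verts := {x | SameComponent H (base x) (target x)}
  Adj x y := (reducedGraph X M).Adj x y ∧ SameComponent H (base x) (target x) ∧
    SameComponent H (base y) (target y) ∧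
    ∀ a b ha hb, x = .old a ha → y = .old b hb → H.Adj a b
  adj_sub h := h.1
  edge_vert h := h.2.1
  symm := ⟨fun _ _ h => ⟨h.1.symm, h.2.2.1, h.2.1,
    fun a b ha hb e e' => (h.2.2.2 b a hb ha e' e).symm⟩⟩

theorem sameComponent_base_of_adj {H : G.Subgraph} {x y : ReducedVertex X M}
    (h : (transferSubgraph X M H).Adj x y) : SameComponent H (base x) (base y) := by
  have key : ∀ x y, ReducedEdge X M x y → (transferSubgraph X M H).Adj x y →
      SameComponent H (base x) (base y) := by
    rintro x y hxy ⟨-, hx, hy, hold⟩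
    cases hxy with
    | keep a b ha hb hab => exact .of_adj (hold a b ha hb rfl rfl)
    | evenLeft => exact hx
    | evenRight => exact hx
    | oddLeft => exact hx
    | oddMid => exact .refl hx.1
    | oddRight => exact hx
  rcases (reducedGraph_adj_iff.1 h.1).2 with h' | h'
  · exact key x y h' h
  · exact (key y x h' h.symm).symm

theorem sameComponent_base_of_reachable {H : G.Subgraph}
    {x y : (transferSubgraph X M H).verts} (h : (transferSubgraph X M H).coe.Reachable x y) :
    SameComponent H (base x.1) (base y.1) := by
  obtain ⟨p⟩ := h
  induction p with
  | @nil x => exact .refl x.2.1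
  | cons h _ ih => exact (sameComponent_base_of_adj h).trans ih

theorem transferSubgraph_le_core {A : OddCycleCut G} {hD : Disjoint A.C (X.B \ M)}
    {hne : A.C.Nonempty ∨ ∃ v ∈ A.B, v ∉ X.B \ M} {H : G.Subgraph} (hH : H ≤ A.core) :
    transferSubgraph X M H ≤ (transferCut A hD hne).core := by
  have hR : ∀ v ∈ H.verts, v ∉ A.R := fun v hv => by
    rcases hH.1 hv with h | h
    · exact A.notMem_R_of_mem_C h
    · exact A.notMem_R_of_mem_B h
  have hverts : ∀ x, SameComponent H (base x) (target x) →
      x ∈ (transferCut A hD hne).C ∪ (transferCut A hD hne).B := by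
    rintro x ⟨h1, h2, -⟩
    rcases (transferCut A hD hne).mem_cases x with h | h | h
    · exact .inr h
    · exact .inl h
    · exact (h.elim (hR _ h1) (hR _ h2)).elim
  exact ⟨hverts, fun x y h => (OddCycleCut.core_adj _).2 ⟨hverts x h.2.1, hverts y h.2.2.1, h.1⟩⟩

/-- An odd cycle transversal of the certificate in the reduced graph yields one of `H` that is no
larger: replace each new vertex by the first end of its path. A two-colouring of the rest extends
to each component of `H[X_B \ M]`, since the new paths record all parities with which its
neighbours are connected through it. -/
theorem isOCT_base_image {f : V → Bool} (hf : ∀ a ∈ X.B, ∀ b ∈ X.B, G.Adj a b → f a ≠ f b)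
    {H : G.Subgraph} {Y : Set (ReducedVertex X M)} (hY : IsOCT (transferSubgraph X M H) Y) :
    IsOCT H (base '' Y) := by
  classical
  obtain ⟨hYH, c', hc'⟩ := (isOCT_iff _ _).1 hY
  set D : Set V := X.B \ M
  refine (isOCT_iff _ _).2 ⟨?_, ?_⟩
  · rintro _ ⟨x, hx, rfl⟩
    exact (hYH hx).1
  have hoff : ∀ x, base x ∉ base '' Y → x ∉ Y := fun x hx h => hx ⟨x, h, rfl⟩
  let c₀ : V → Bool := fun v => if h : v ∈ D then false else c' (.old v h)
  have hc₀ : ∀ v (h : v ∉ D), c₀ v = c' (.old v h) := fun v h => dif_neg h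
  let HD : SimpleGraph D := H.spanningCoe.induce D
  have hHDle : HD ≤ G.induce D := fun a b h => H.adj_sub h
  have hlen : ∀ {a b : D} (p : (G.induce D).Walk a b), f a = f b ↔ Even p.length := by
    intro a b p
    induction p with
    | nil => simp
    | @cons a c b hac p ih =>
      rw [SimpleGraph.Walk.length_cons, Nat.even_add_one, ← ih]
      have := hf a a.2.1 c c.2.1 hac
      revert this
      cases f a <;> cases f b <;> cases f c <;> simp
  have hcomp : ∀ {a b : D}, HD.Reachable a b → (a : V) ∈ H.verts →
      SameComponent H (a : V) (b : V) := by
    rintro a b ⟨p⟩ ha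
    induction p with
    | nil => exact .refl ha
    | cons h p ih =>
      have h' : H.Adj _ _ := h
      exact (SameComponent.of_adj h').trans (ih h'.snd_mem)
  have hside : ∀ u ∉ D, ∀ a : D, H.Adj u a → u ∈ X.C ∪ M := by
    intro u hu a hua
    by_contra h
    have huB : u ∈ X.B := X.mem_B_of_adj a.2.1 (H.adj_sub hua).symm fun h' => h (.inl h')
    exact hu ⟨huB, fun h' => h (.inr h')⟩
  -- `good u a x`: the surviving old vertex `u` determines the colour of `x` through its
  -- neighbour `a` in the component of `x`.
  let good : V → D → D → Prop := fun u a x =>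
    u ∉ D ∧ u ∉ base '' Y ∧ H.Adj u a ∧ HD.Reachable a x
  let val : V → D → D → Bool := fun u a x => xor (c₀ u) (f a == f x)
  have hcons : ∀ u a v b x, good u a x → good v b x → val u a x = val v b x := by
    rintro u a v b x ⟨huD, huY, hua, hax⟩ ⟨hvD, hvY, hvb, hbx⟩
    have hab := hax.trans hbx.symm
    have hsame : SameComponent H u v :=
      ((SameComponent.of_adj hua).trans (hcomp hab hua.snd_mem)).trans
        (SameComponent.of_adj hvb).symm
    obtain ⟨p, hp⟩ := (hab.mono hHDle).exists_isPath
    have hpl := hlen p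
    have huM := hside u huD a hua
    have hvM := hside v hvD b hvb
    have hsu : SameComponent H u u := .refl hua.fst_mem
    have hsv : SameComponent H v v := .refl hvb.fst_mem
    suffices h : c₀ u = c₀ v ↔ f a = f b by
      revert h
      simp only [val]
      cases c₀ u <;> cases c₀ v <;> cases f a <;> cases f b <;> cases f x <;> simp
    rw [hpl, hc₀ u huD, hc₀ v hvD]
    by_cases heven : Even p.length
    · have hct : ConnectsThrough G D Even u v :=
        ⟨a, b, p, hp, H.adj_sub hua, (H.adj_sub hvb).symm, heven.add even_two⟩
      have h1 := hc' (.old u huD) (.mid u v huM hvM hct true)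
        ⟨(ReducedEdge.evenLeft u v huM hvM hct true huD).adj, hsu, hsame, by
          rintro _ _ _ _ - ⟨⟩⟩ (hoff _ huY) (hoff _ huY)
      have h2 := hc' (.mid u v huM hvM hct true) (.old v hvD)
        ⟨(ReducedEdge.evenRight u v huM hvM hct true hvD).adj, hsame, hsv, by
          rintro _ _ _ _ ⟨⟩⟩ (hoff _ huY) (hoff _ hvY)
      refine iff_of_true ?_ heven
      revert h1 h2
      cases c' (.old u huD) <;> cases c' (.old v hvD) <;>
        cases c' (.mid u v huM hvM hct true) <;> simp
    · have hct : ConnectsThrough G D Odd u v :=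
        ⟨a, b, p, hp, H.adj_sub hua, (H.adj_sub hvb).symm,
          (Nat.not_even_iff_odd.1 heven).add_even even_two⟩
      have h1 := hc' (.old u huD) (.fst u v huM hvM hct true)
        ⟨(ReducedEdge.oddLeft u v huM hvM hct true huD).adj, hsu, hsame, by
          rintro _ _ _ _ - ⟨⟩⟩ (hoff _ huY) (hoff _ huY)
      have h2 := hc' (.fst u v huM hvM hct true) (.snd u v huM hvM hct true)
        ⟨(ReducedEdge.oddMid u v huM hvM hct true).adj, hsame, hsame, by
          rintro _ _ _ _ ⟨⟩⟩ (hoff _ huY) (hoff _ huY)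
      have h3 := hc' (.snd u v huM hvM hct true) (.old v hvD)
        ⟨(ReducedEdge.oddRight u v huM hvM hct true hvD).adj, hsame, hsv, by
          rintro _ _ _ _ ⟨⟩⟩ (hoff _ huY) (hoff _ hvY)
      refine iff_of_false ?_ heven
      revert h1 h2 h3
      cases c' (.old u huD) <;> cases c' (.old v hvD) <;>
        cases c' (.fst u v huM hvM hct true) <;> cases c' (.snd u v huM hvM hct true) <;> simp
  let cD : D → Bool := fun x =>
    if h : ∃ q : V × D, good q.1 q.2 x then val h.choose.1 h.choose.2 x else f x
  have hcD : ∀ u a x, good u a x → cD x = val u a x := by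
    intro u a x h
    have hex : ∃ q : V × D, good q.1 q.2 x := ⟨(u, a), h⟩
    simp only [cD, dif_pos hex]
    exact hcons _ _ _ _ _ hex.choose_spec h
  have hcDadj : ∀ x y : D, H.Adj x y → cD x ≠ cD y := by
    intro x y hxy
    have hfxy := hf x x.2.1 y y.2.1 (H.adj_sub hxy)
    have hstep : ∀ {x y : D}, H.Adj x y → ∀ q : V × D, good q.1 q.2 x → good q.1 q.2 y :=
      fun {x y} hxy q h => ⟨h.1, h.2.1, h.2.2.1,
        h.2.2.2.trans (SimpleGraph.Adj.reachable (G := HD) hxy)⟩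
    by_cases hex : ∃ q : V × D, good q.1 q.2 x
    · obtain ⟨q, hq⟩ := hex
      rw [hcD _ _ _ hq, hcD _ _ _ (hstep hxy q hq)]
      revert hfxy
      simp only [val]
      cases c₀ q.1 <;> cases f q.2 <;> cases f x <;> cases f y <;> simp
    · have hey : ¬ ∃ q : V × D, good q.1 q.2 y :=
        fun ⟨q, hq⟩ => hex ⟨q, hstep hxy.symm q hq⟩
      simpa only [cD, dif_neg hex, dif_neg hey] using hfxy
  have hcDold : ∀ u ∉ D, u ∉ base '' Y → ∀ x : D, H.Adj u x → c₀ u ≠ cD x := by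
    intro u hu huY x hux
    rw [hcD u x x ⟨hu, huY, hux, .rfl⟩]
    simp [val]
  refine ⟨fun v => if h : v ∈ D then cD ⟨v, h⟩ else c₀ v, fun a b hab ha hb => ?_⟩
  by_cases haD : a ∈ D <;> by_cases hbD : b ∈ D
  · simpa only [dif_pos haD, dif_pos hbD] using hcDadj ⟨a, haD⟩ ⟨b, hbD⟩ hab
  · simpa only [dif_pos haD, dif_neg hbD] using (hcDold b hbD hb ⟨a, haD⟩ hab.symm).symm
  · simpa only [dif_neg haD, dif_pos hbD] using hcDold a haD ha ⟨b, hbD⟩ hab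
  · simp only [dif_neg haD, dif_neg hbD, hc₀ a haD, hc₀ b hbD]
    refine hc' _ _ ⟨(ReducedEdge.keep a b haD hbD (H.adj_sub hab)).adj, .refl hab.fst_mem,
      .refl hab.snd_mem, ?_⟩ (hoff _ ha) (hoff _ hb)
    rintro _ _ _ _ ⟨⟩ ⟨⟩
    exact hab

theorem base_image_transferCut_C {A : OddCycleCut G} {hD : Disjoint A.C (X.B \ M)}
    {hne : A.C.Nonempty ∨ ∃ v ∈ A.B, v ∉ X.B \ M} : base '' (transferCut A hD hne).C = A.C := by
  ext v
  constructor
  · rintro ⟨_, ⟨v, h, rfl, hv⟩, rfl⟩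
    exact hv
  · exact fun hv => ⟨.old v fun h => Set.disjoint_left.1 hD hv h, ⟨v, _, rfl, hv⟩, rfl⟩

theorem injOn_base_transferCut_C {A : OddCycleCut G} {hD : Disjoint A.C (X.B \ M)}
    {hne : A.C.Nonempty ∨ ∃ v ∈ A.B, v ∉ X.B \ M} : Set.InjOn base (transferCut A hD hne).C := by
  rintro _ ⟨v, h, rfl, -⟩ _ ⟨w, h', rfl, -⟩ e
  cases (show v = w from e)
  rfl

theorem width_transferCut (A : OddCycleCut G) (hD : Disjoint A.C (X.B \ M))
    (hne : A.C.Nonempty ∨ ∃ v ∈ A.B, v ∉ X.B \ M) : (transferCut A hD hne).width = A.width := by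
  unfold OddCycleCut.width
  rw [← base_image_transferCut_C (hD := hD) (hne := hne), injOn_base_transferCut_C.ncard_image]

theorem OddCycleCut.IsTightOfOrder.transfer [Finite V] {A : OddCycleCut G} {z : ℕ}
    (hA : A.IsTightOfOrder z) (hD : Disjoint A.C (X.B \ M))
    (hne : A.C.Nonempty ∨ ∃ v ∈ A.B, v ∉ X.B \ M) : (transferCut A hD hne).IsTightOfOrder z := by
  obtain ⟨-, H, hH, ⟨hCH, -⟩, hmin, hK⟩ := hA
  obtain ⟨f, hf⟩ := X.exists_coloring
  have hle := transferSubgraph_le_core (hD := hD) (hne := hne) hH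
  have hC : (transferCut A hD hne).C ⊆ (transferSubgraph X M H).verts := by
    rintro _ ⟨v, h, rfl, hv⟩
    exact .refl (hCH hv)
  have hO := OddCycleCut.isOCT_of_le_core _ hle hC
  refine OddCycleCut.isTightOfOrder_of_isCertificate _ hle
    ⟨hO, ncard_eq_octNumber hO fun Y hY => ?_, fun K => ?_⟩
  · have h1 := octNumber_le_ncard (isOCT_base_image hf hY)
    have h2 : (base '' Y).ncard ≤ Y.ncard := Set.ncard_image_le
    have h3 : (transferCut A hD hne).C.ncard = A.C.ncard := width_transferCut A hD hne
    omega
  · obtain ⟨k, rfl⟩ := K.exists_rep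
    refine le_trans ?_ (hK (H.coe.connectedComponentMk ⟨base k.1, k.2.1⟩))
    refine Set.ncard_le_ncard_of_injOn base ?_ (injOn_base_transferCut_C.mono Set.inter_subset_left)
    rintro x ⟨⟨v, h, rfl, hv⟩, y, hy, e⟩
    refine ⟨hv, ?_⟩
    have hr := sameComponent_base_of_reachable (SimpleGraph.ConnectedComponent.exact hy)
    rw [e] at hr
    obtain ⟨h1, h2, hr⟩ := hr
    exact ⟨⟨v, h1⟩, SimpleGraph.ConnectedComponent.sound hr, rfl⟩

end Transfer

theorem mainTheorem5 {V : Type u} [Finite V] (G : SimpleGraph V)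
    (X : OddCycleCut G) (M : Set V) (hM : IsMarkedSet X M)
    (z : ℕ) (A : OddCycleCut G) (hA : A.IsTightOfOrder z)
    (hne : A.C.Nonempty ∨ ∃ v ∈ A.B, v ∉ X.B \ M) :
    ∃ A' : OddCycleCut (reducedGraph X M), A'.IsTightOfOrder z ∧ A'.width = A.width := by
  obtain ⟨A₁, hA₁, hw, hD, hsub⟩ := hA.exists_disjoint_unmarked hM
  have hne₁ : A₁.C.Nonempty ∨ ∃ v ∈ A₁.B, v ∉ X.B \ M := by
    rcases hne with h | ⟨v, hv, hvD⟩
    · left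
      have hw' : A₁.C.ncard = A.C.ncard := hw
      rw [← Set.ncard_pos] at h ⊢
      omega
    · exact (hsub (.inr hv)).imp (fun h => ⟨v, h⟩) (fun h => ⟨v, h, hvD⟩)
  exact ⟨transferCut A₁ hD hne₁, hA₁.transfer hD hne₁, (width_transferCut A₁ hD hne₁).trans hw⟩
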